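/- Let $P_S,\sigma^2,d_{SD},M,\lambda_1>0$, let $\alpha\in\mathbb{R}$ and $\Gamma'_{th}\in[0,\infty]$, and put $W_2=\sigma^2 d_{SD}^{\alpha}/P_S$, with the convention $e^{-W_2\Gamma'_{th}}=0$ if $\Gamma'_{th}=\infty$. Let $h(i)$, $i\ge 0$, be circularly symmetric complex Gaussian variables with mean $0$ and variance $d_{SD}^{-\alpha}$, let $X(i)$, $i\ge 0$, be exponential variables with rate $\lambda_1$ (density $f_X(x)=\lambda_1e^{-\lambda_1x}$ for $x\ge0$), and let $B(0)\ge 0$ be a random variable, all of them mutually independent. Let $\gamma_{SD}(i)=P_S|h(i)|^2/\sigma^2$, and define the energy levels of the infinite-size buffer under the incremental best-effort policy by $$B(i+1)=\begin{cases}B(i)+X(i) & \text{if }\gamma_{SD}(i)\ge\Gamma'_{th},\\ B(i)-M+X(i) & \text{if }\gamma_{SD}(i)<\Gamma'_{th}\text{ and }B(i)\ge M,\\ X(i) & \text{if }\gamma_{SD}(i)<\Gamma'_{th}\text{ and }B(i)<M.\end{cases}$$ If $\phi_{inc}=M\lambda_1\left(1-e^{-W_2\Gamma'_{th}}\right)>1$,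 then $B(i)$ converges in distribution, as $i\to\infty$, to a probability distribution on $\mathbb{R}$ whose CDF $G$ satisfies, for all $x\ge0$, $$G(x)=\int_0^x\left[e^{-W_2\Gamma'_{th}}f_X(x-u)\,G(u)+\left(1-e^{-W_2\Gamma'_{th}}\right)f_X(u)\,G(x+M-u)\right]du .$$ This $G$ is the only CDF of a probability distribution on $\mathbb{R}$ that satisfies the equation, and it is given by $G(x)=1-e^{-Z_1x}$ for $x\ge0$ and $G(x)=0$ for $x<0$, where $$Z_1=\frac{\mathcal{W}\left(-\left(1-e^{-W_2\Gamma'_{th}}\right)\lambda_1M\exp\left(-\left(1-e^{-W_2\Gamma'_{th}}\right)\lambda_1M\right)\right)}{M}+\left(1-e^{-W_2\Gamma'_{th}}\right)\lambda_1>0$$ and $\mathcal{W}$ is the principal branch of the Lambert-W function (for $x\ge -1/e$, $\mathcal{W}(x)$ is the unique $w\ge-1$ with $we^w=x$). -/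

import Mathlib

open MeasureTheory ProbabilityTheory Filter Topology
open scoped NNReal ENNReal

noncomputable section

/-- The principal branch of the Lambert W-function: for `x ≥ -1/e`, the unique `w ≥ -1` with
`w * exp w = x`. -/
def lambertW (x : ℝ) : ℝ :=
  Function.invFunOn (fun w : ℝ => w * Real.exp w) (Set.Ici (-1)) x

/-- The circularly symmetric complex Gaussian law with mean `m` and variance `v`: real and
imaginary parts are independent real Gaussians of variance `v / 2`. -/
def complexGaussian (m : ℂ) (v : ℝ≥0) : Measure ℂ :=
  ((gaussianReal m.re (v / 2)).prod (gaussianReal m.im (v / 2))).map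
    (fun p : ℝ × ℝ => (⟨p.1, p.2⟩ : ℂ))

/-- The instantaneous signal to noise ratio of a link with channel gain `h`, transmit power `PS`
and noise power `noise`. -/
def linkSNR (PS noise : ℝ) (h : ℂ) : ℝ := PS * ‖h‖ ^ 2 / noise

/-- The constant `W₂ = σ² d ^ α / P_S`. -/
def W2 (PS noise d α : ℝ) : ℝ := noise * d ^ α / PS

/-- `exp (-w Γ)` for a threshold `Γ ∈ [0, ∞]`, with `exp (-∞) = 0`. -/
def expNegMul (w : ℝ) (Γ : ℝ≥0∞) : ℝ :=
  if Γ = ⊤ then 0 else Real.exp (-(w * Γ.toReal))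

/-- One step of the best-effort energy buffer: current level `b`, SNR `g` of the direct link,
harvested energy `x`. The first case is an ACK, the other two are a NACK. -/
def ibepStep (M : ℝ) (Γ : ℝ≥0∞) (b g x : ℝ) : ℝ :=
  if Γ ≤ ENNReal.ofReal g then b + x
  else if M ≤ b then b - M + x
  else x

/-- The energy levels `B(0), B(1), …` of the infinite-size buffer, with initial level `B0`, direct
link SNRs `g i` and harvested energies `X i`. -/
def ibepBuffer {Ω : Type*} (M : ℝ) (Γ : ℝ≥0∞) (B0 : Ω → ℝ) (g X : ℕ → Ω → ℝ) : ℕ → Ω → ℝ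
  | 0 => B0
  | i + 1 => fun ω => ibepStep M Γ (ibepBuffer M Γ B0 g X i ω) (g i ω) (X i ω)

/-- `φ_inc`, with `q = exp (-W₂ Γ)` the probability of an ACK. -/
def phiInc (M lam q : ℝ) : ℝ := M * lam * (1 - q)

/-- The exponent `Z₁`, with `q = exp (-W₂ Γ)`. -/
def Z1 (M lam q : ℝ) : ℝ :=
  lambertW (-((1 - q) * lam * M) * Real.exp (-((1 - q) * lam * M))) / M + (1 - q) * lam

/-- The integral equation for the limiting distribution function, where the harvested energy has
the exponential density of rate `lam`. -/
def SatisfiesIntegralEquation (M lam q : ℝ) (G : ℝ → ℝ) : Prop :=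
  ∀ x : ℝ, 0 ≤ x →
    G x = ∫ u in (0 : ℝ)..x,
      (q * exponentialPDFReal lam (x - u) * G u
        + (1 - q) * exponentialPDFReal lam u * G (x + M - u))

end

/-!
# The limit law of the incremental best-effort energy buffer

For nonnegative levels a step of the buffer is `b ↦ max (b - M · 1_NACK) 0 + x`. Two buffers fed
with the same inputs, one of them started from empty, have merged after the first NACK at which the
higher level is below `M`; until then the higher level is a random walk whose increments
`x - M · 1_NACK` have mean `1/λ - (1 - q) M`, where `q = exp (-W₂ Γ)` is the probability of an ACK.
If `φ_inc > 1` this mean is negative, so by the strong law of large numbers the walk would become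
negative: hence any two buffers with the same inputs merge almost surely
(`eventually_ibepBuffer_eq`, `ae_tendsto_netIncrement`).

Conditioning on the harvested energy shows that a law whose distribution function satisfies the
integral equation lives on `(0, ∞)` and is invariant under a step
(`SatisfiesIntegralEquation.nextLaw_eq`). Starting a second buffer from such a law `ν`, on the
product of `Ω` with `ℝ`, gives a stationary copy that merges with the given buffer, so the latter
converges in distribution to `ν` (`tendstoInDistribution_ibepBuffer`). This yields both convergence
and, as limits in distribution are unique, uniqueness of the solution.

It remains to exhibit one solution. The exponential law of rate `Z` solves the equation when
`Z = (1 - q) λ (1 - exp (-M Z))`, and the Lambert function provides the positive root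
(`Z1_spec`, `satisfiesIntegralEquation_expMeasure`). The probability `q` of an ACK comes from the
Gaussian law of the channel gain in polar coordinates (`complexGaussian_ack`).
-/

/-! ### Paths of the buffer -/

section Paths

variable {Ω : Type*} {M : ℝ} {Γ : ℝ≥0∞}

/-- The net change `x - M · 1_NACK` of the energy level in a slot, before truncation. -/
noncomputable def netIncrement (M : ℝ) (Γ : ℝ≥0∞) (g x : ℝ) : ℝ :=
  x - if Γ ≤ ENNReal.ofReal g then 0 else M

lemma ibepStep_nonneg {b g x : ℝ} (hb : 0 ≤ b) (hx : 0 ≤ x) : 0 ≤ ibepStep M Γ b g x := by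
  unfold ibepStep; split_ifs <;> linarith

/-- A path depends on the driving sequences only through their values at the sample point. -/
lemma ibepBuffer_comp {Ω' : Type*} (f : Ω' → Ω) (B : Ω' → ℝ) (g X : ℕ → Ω → ℝ) (i : ℕ) (p : Ω') :
    ibepBuffer M Γ B (fun i p => g i (f p)) (fun i p => X i (f p)) i p
      = ibepBuffer M Γ (fun _ => B p) g X i (f p) := by
  induction i with
  | zero => rfl
  | succ i ih => simp only [ibepBuffer, ih]

lemma ibepBuffer_nonneg {B : Ω → ℝ} {g X : ℕ → Ω → ℝ} {ω : Ω} (hB : 0 ≤ B ω)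
    (hX : ∀ i, 0 ≤ X i ω) (i : ℕ) : 0 ≤ ibepBuffer M Γ B g X i ω := by
  induction i with
  | zero => exact hB
  | succ i ih => exact ibepStep_nonneg ih (hX i)

/-- Two paths with the same inputs, one started from an empty buffer, either have met or the
higher one has not been truncated yet: a truncation of the higher path resets both. -/
lemma ibepBuffer_eq_or_le {B : Ω → ℝ} {g X : ℕ → Ω → ℝ} {ω : Ω} (hB : 0 ≤ B ω)
    (hX : ∀ i, 0 ≤ X i ω) (i : ℕ) :
    ibepBuffer M Γ B g X i ω = ibepBuffer M Γ 0 g X i ω ∨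
      (ibepBuffer M Γ B g X i ω
          = B ω + ∑ j ∈ Finset.range i, netIncrement M Γ (g j ω) (X j ω) ∧
        ibepBuffer M Γ 0 g X i ω ≤ ibepBuffer M Γ B g X i ω) := by
  induction i with
  | zero => right; simpa [ibepBuffer] using hB
  | succ i ih =>
    rcases ih with h | ⟨h1, h2⟩
    · left; simp only [ibepBuffer, h]
    -- A NACK with the higher level below `M` leaves only the new harvest in both buffers.
    · have h0 : 0 ≤ ibepBuffer M Γ 0 g X i ω := ibepBuffer_nonneg (B := 0) le_rfl hX i
      rw [Finset.sum_range_succ, ← add_assoc, ← h1]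
      simp only [ibepBuffer, ibepStep, netIncrement]
      split_ifs <;> first
        | (right; constructor <;> linarith)
        | (left; linarith)

/-- Two paths with the same inputs coincide from the first time at which the untruncated walk of
the higher one would be negative. -/
lemma ibepBuffer_eq_of_sum_neg {B : Ω → ℝ} {g X : ℕ → Ω → ℝ} {ω : Ω}
    (hB : 0 ≤ B ω) (hX : ∀ i, 0 ≤ X i ω) {n : ℕ}
    (hn : B ω + ∑ j ∈ Finset.range n, netIncrement M Γ (g j ω) (X j ω) < 0) :
    ibepBuffer M Γ B g X n ω = ibepBuffer M Γ 0 g X n ω := by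
  rcases ibepBuffer_eq_or_le (Γ := Γ) (g := g) hB hX n with h | ⟨h, -⟩
  · exact h
  · have := ibepBuffer_nonneg (M := M) (Γ := Γ) (g := g) hB hX n
    linarith

/-- A path forgets its initial level when the mean net increment is negative. -/
lemma eventually_ibepBuffer_eq {B : Ω → ℝ} {g X : ℕ → Ω → ℝ} {ω : Ω}
    (hB : 0 ≤ B ω) (hX : ∀ i, 0 ≤ X i ω) {m : ℝ} (hm : m < 0)
    (hlim : Tendsto (fun n : ℕ =>
      (∑ j ∈ Finset.range n, netIncrement M Γ (g j ω) (X j ω)) / n) atTop (𝓝 m)) :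
    ∀ᶠ n in atTop, ibepBuffer M Γ B g X n ω = ibepBuffer M Γ 0 g X n ω := by
  have hB' : Tendsto (fun n : ℕ => B ω / n) atTop (𝓝 0) :=
    tendsto_const_div_atTop_nhds_zero_nat _
  have hsum := hB'.add hlim
  rw [zero_add] at hsum
  filter_upwards [hsum.eventually_lt_const hm, eventually_gt_atTop 0] with n hn hn0
  refine ibepBuffer_eq_of_sum_neg hB hX ?_
  rw [← add_div] at hn
  have hn0' : (0 : ℝ) < n := by exact_mod_cast hn0
  by_contra! hcon
  exact absurd hn (not_lt.2 (div_nonneg hcon hn0'.le))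

lemma measurable_ibepStep :
    Measurable (fun p : ℝ × ℝ × ℝ => ibepStep M Γ p.1 p.2.1 p.2.2) := by
  unfold ibepStep
  refine Measurable.ite (measurableSet_le measurable_const (by fun_prop)) (by fun_prop) ?_
  exact Measurable.ite (measurableSet_le measurable_const (by fun_prop)) (by fun_prop)
    (by fun_prop)

lemma measurable_ibepBuffer {m : MeasurableSpace Ω} {B : Ω → ℝ} {g X : ℕ → Ω → ℝ}
    (hB : Measurable B) (i : ℕ) (hg : ∀ j < i, Measurable (g j))
    (hX : ∀ j < i, Measurable (X j)) : Measurable (ibepBuffer M Γ B g X i) := by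
  induction i with
  | zero => exact hB
  | succ i ih =>
    exact measurable_ibepStep.comp
      ((ih (fun j hj => hg j (by omega)) (fun j hj => hX j (by omega))).prodMk
        ((hg i (by omega)).prodMk (hX i (by omega))))

end Paths

/-! ### The law of the signal to noise ratio -/

/-- The tail of the Rayleigh density. -/
lemma lintegral_Ioi_rayleigh {v s : ℝ} (hv : 0 < v) (hs : 0 ≤ s) :
    ∫⁻ r in Set.Ioi s, ENNReal.ofReal (2 * r / v * Real.exp (-(r ^ 2 / v)))
      = ENNReal.ofReal (Real.exp (-(s ^ 2 / v))) := by
  have hderiv : ∀ r ∈ Set.Ici s, HasDerivAt (fun r : ℝ => -Real.exp (-(r ^ 2 / v)))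
      (2 * r / v * Real.exp (-(r ^ 2 / v))) r := by
    intro r _
    have h := (((hasDerivAt_pow 2 r).div_const v).neg.exp).neg
    convert! h using 1
    simp only [Pi.neg_apply]
    push_cast
    ring
  have hpos : ∀ r ∈ Set.Ioi s, 0 ≤ 2 * r / v * Real.exp (-(r ^ 2 / v)) := by
    intro r hr
    have : 0 ≤ r := hs.trans (le_of_lt hr)
    positivity
  have hlim : Tendsto (fun r : ℝ => -Real.exp (-(r ^ 2 / v))) atTop (𝓝 0) := by
    have h : Tendsto (fun r : ℝ => r ^ 2 / v) atTop atTop :=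
      (tendsto_pow_atTop two_ne_zero).atTop_div_const hv
    simpa using (Real.tendsto_exp_neg_atTop_nhds_zero.comp h).neg
  rw [← ofReal_integral_eq_lintegral_ofReal (integrableOn_Ioi_deriv_of_nonneg' hderiv hpos hlim)
    ((ae_restrict_iff' measurableSet_Ioi).2 (ae_of_all _ hpos)),
    integral_Ioi_of_hasDerivAt_of_nonneg' hderiv hpos hlim]
  simp

lemma gaussianPDF_mul_gaussianPDF {v : ℝ≥0} (hv : 0 < v) (x y : ℝ) :
    gaussianPDF 0 (v / 2) x * gaussianPDF 0 (v / 2) y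
      = ENNReal.ofReal ((Real.pi * v)⁻¹ * Real.exp (-((x ^ 2 + y ^ 2) / v))) := by
  have hv' : (0 : ℝ) < v := hv
  rw [gaussianPDF, gaussianPDF, ← ENNReal.ofReal_mul (gaussianPDFReal_nonneg _ _ _)]
  congr 1
  simp only [gaussianPDFReal, NNReal.coe_div, NNReal.coe_ofNat, sub_zero]
  have h1 : 2 * Real.pi * ((v : ℝ) / 2) = Real.pi * v := by ring
  have h2 : 2 * ((v : ℝ) / 2) = v := by ring
  rw [h1, h2, mul_mul_mul_comm, ← mul_inv, Real.mul_self_sqrt (by positivity), ← Real.exp_add]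
  congr 2
  ring

/-- The squared modulus of a circularly symmetric complex Gaussian variable is exponential: in
polar coordinates the density is `r / (π v) · exp (- r ^ 2 / v)`. -/
lemma complexGaussian_tail {v : ℝ≥0} (hv : 0 < v) {t : ℝ} (ht : 0 ≤ t) :
    complexGaussian 0 v {z | t ≤ ‖z‖ ^ 2} = ENNReal.ofReal (Real.exp (-(t / v))) := by
  have hv' : (0 : ℝ) < v := hv
  have hv2 : v / 2 ≠ 0 := by positivity
  have hmeas : Measurable (fun p : ℝ × ℝ => (⟨p.1, p.2⟩ : ℂ)) :=
    Complex.measurableEquivRealProd.symm.measurable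
  have hset : MeasurableSet {z : ℂ | t ≤ ‖z‖ ^ 2} :=
    measurableSet_le measurable_const (by fun_prop)
  have hpre : (fun p : ℝ × ℝ => (⟨p.1, p.2⟩ : ℂ)) ⁻¹' {z | t ≤ ‖z‖ ^ 2}
      = {p | t ≤ p.1 ^ 2 + p.2 ^ 2} := by
    ext p
    simp only [Set.mem_preimage, Set.mem_ofPred_eq, Complex.sq_norm, Complex.normSq_mk]
    rw [sq, sq]
  have hset' : MeasurableSet {p : ℝ × ℝ | t ≤ p.1 ^ 2 + p.2 ^ 2} :=
    measurableSet_le measurable_const (by fun_prop)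
  rw [complexGaussian, Measure.map_apply hmeas hset, hpre]
  simp only [Complex.zero_re, Complex.zero_im]
  rw [gaussianReal_of_var_ne_zero _ hv2,
    prod_withDensity (measurable_gaussianPDF _ _) (measurable_gaussianPDF _ _),
    withDensity_apply _ hset', ← lintegral_indicator hset',
    ← Measure.volume_eq_prod, ← lintegral_comp_polarCoord_symm]
  have hpolar : ∀ p ∈ polarCoord.target, ENNReal.ofReal p.1 •
      ({p : ℝ × ℝ | t ≤ p.1 ^ 2 + p.2 ^ 2}.indicator
        (fun z => gaussianPDF 0 (v / 2) z.1 * gaussianPDF 0 (v / 2) z.2) (polarCoord.symm p))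
      = (Set.Ici √t).indicator
          (fun r => ENNReal.ofReal (2 * r / v * Real.exp (-(r ^ 2 / v)))) p.1
        * ENNReal.ofReal (2 * Real.pi)⁻¹ := by
    rintro ⟨r, θ⟩ ⟨hr, -⟩
    replace hr : 0 < r := hr
    have hsq : (r * Real.cos θ) ^ 2 + (r * Real.sin θ) ^ 2 = r ^ 2 := by
      linear_combination r ^ 2 * Real.cos_sq_add_sin_sq θ
    have hiff : r ∈ Set.Ici √t ↔ t ≤ r ^ 2 := Real.sqrt_le_left hr.le
    simp only [polarCoord_symm_apply, Set.indicator_apply, Set.mem_ofPred_eq, hsq, hiff,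
      smul_eq_mul, gaussianPDF_mul_gaussianPDF hv]
    split_ifs
    · rw [← ENNReal.ofReal_mul hr.le, ← ENNReal.ofReal_mul (by positivity)]
      congr 1
      field_simp
    · simp
  have hm : Measurable ((Set.Ici √t).indicator
      (fun r => ENNReal.ofReal (2 * r / v * Real.exp (-(r ^ 2 / v))))) :=
    Measurable.indicator (by fun_prop) measurableSet_Ici
  rw [setLIntegral_congr_fun polarCoord.open_target.measurableSet hpolar, polarCoord_target,
    Measure.volume_eq_prod, setLIntegral_prod _ (by fun_prop)]
  simp only [lintegral_const, Measure.restrict_apply_univ, Real.volume_Ioo]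
  rw [lintegral_mul_const _ (by fun_prop), lintegral_mul_const _ hm, mul_assoc,
    ← ENNReal.ofReal_mul (by positivity)]
  have hone : (2 * Real.pi)⁻¹ * (Real.pi - -Real.pi) = 1 := by
    field_simp; ring
  rw [hone, ENNReal.ofReal_one, mul_one, lintegral_indicator measurableSet_Ici,
    Measure.restrict_restrict measurableSet_Ici]
  have hae : (Set.Ici √t ∩ Set.Ioi 0 : Set ℝ) =ᵐ[volume] Set.Ioi √t := by
    have h1 : (Set.Ioi √t : Set ℝ) ∩ Set.Ioi 0 = Set.Ioi √t :=
      Set.inter_eq_left.2 (Set.Ioi_subset_Ioi (Real.sqrt_nonneg t))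
    have := (Ioi_ae_eq_Ici (μ := volume) (a := √t)).symm.inter (ae_eq_refl (Set.Ioi (0 : ℝ)))
    rwa [h1] at this
  rw [setLIntegral_congr hae, lintegral_Ioi_rayleigh hv' (Real.sqrt_nonneg t), Real.sq_sqrt ht]

lemma expNegMul_nonneg (w : ℝ) (Γ : ℝ≥0∞) : 0 ≤ expNegMul w Γ := by
  unfold expNegMul
  split_ifs
  · exact le_rfl
  · positivity

/-- An ACK has probability `exp (-W₂ Γ)`. -/
lemma complexGaussian_ack {PS noise d α : ℝ} (hPS : 0 < PS) (hnoise : 0 < noise) (hd : 0 < d)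
    (Γ : ℝ≥0∞) :
    complexGaussian 0 (d ^ (-α)).toNNReal {z | Γ ≤ ENNReal.ofReal (linkSNR PS noise z)}
      = ENNReal.ofReal (expNegMul (W2 PS noise d α) Γ) := by
  have hd' : 0 < d ^ (-α) := Real.rpow_pos_of_pos hd _
  unfold expNegMul
  split_ifs with hΓ
  · simp [hΓ]
  · have hset : {z | Γ ≤ ENNReal.ofReal (linkSNR PS noise z)}
        = {z | noise * Γ.toReal / PS ≤ ‖z‖ ^ 2} := by
      ext z
      have h0 : 0 ≤ linkSNR PS noise z := by unfold linkSNR; positivity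
      rw [Set.mem_ofPred_eq, Set.mem_ofPred_eq, ENNReal.le_ofReal_iff_toReal_le hΓ h0, linkSNR,
        le_div_iff₀ hnoise, div_le_iff₀ hPS, mul_comm PS, mul_comm noise]
    rw [hset, complexGaussian_tail (Real.toNNReal_pos.2 hd') (by positivity),
      Real.coe_toNNReal _ hd'.le, W2, Real.rpow_neg hd.le]
    congr 3
    have := Real.rpow_pos_of_pos hd α
    field_simp

/-! ### The exponential distribution -/

section Exponential

variable {lam : ℝ}

lemma exponentialPDFReal_of_nonneg {x : ℝ} (hx : 0 ≤ x) :
    exponentialPDFReal lam x = lam * Real.exp (-(lam * x)) := by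
  simp [exponentialPDFReal, gammaPDFReal, hx]

lemma expMeasure_eq_withDensity : expMeasure lam = volume.withDensity (exponentialPDF lam) := rfl

lemma measurable_exponentialPDF : Measurable (exponentialPDF lam) :=
  (measurable_exponentialPDFReal lam).ennreal_ofReal

lemma ae_expMeasure_nonneg : ∀ᵐ x ∂expMeasure lam, 0 ≤ x := by
  rw [expMeasure_eq_withDensity, ae_withDensity_iff measurable_exponentialPDF]
  refine ae_of_all _ fun x hx => ?_
  by_contra! h
  exact hx (exponentialPDF_of_neg h)

lemma setIntegral_Ioi_id_mul_exp (hlam : 0 < lam) :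
    ∫ x in Set.Ioi (0 : ℝ), x * (lam * Real.exp (-(lam * x))) = 1 / lam := by
  have h := Real.integral_rpow_mul_exp_neg_mul_Ioi (a := 2) (by norm_num) hlam
  have h2 : Real.Gamma 2 = 1 := by simp
  rw [h2, mul_one] at h
  have h3 : ∀ x ∈ Set.Ioi (0 : ℝ), x * (lam * Real.exp (-(lam * x)))
      = lam * (x ^ ((2 : ℝ) - 1) * Real.exp (-(lam * x))) := by
    intro x _
    norm_num
    ring
  rw [setIntegral_congr_fun measurableSet_Ioi h3, integral_const_mul, h]
  norm_num
  field_simp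

lemma toReal_exponentialPDF_smul (x : ℝ) (hlam : 0 < lam) :
    (exponentialPDF lam x).toReal • x
      = (Set.Ici (0 : ℝ)).indicator (fun x => x * (lam * Real.exp (-(lam * x)))) x := by
  rw [exponentialPDF_eq, Set.indicator_apply]
  simp only [Set.mem_Ici, smul_eq_mul]
  split_ifs
  · rw [ENNReal.toReal_ofReal (by positivity), mul_comm]
  · simp

lemma integral_id_expMeasure (hlam : 0 < lam) : ∫ x, x ∂expMeasure lam = 1 / lam := by
  rw [expMeasure_eq_withDensity, integral_withDensity_eq_integral_toReal_smul
    measurable_exponentialPDF (ae_of_all _ fun x => ENNReal.ofReal_lt_top)]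
  simp_rw [toReal_exponentialPDF_smul _ hlam]
  rw [integral_indicator measurableSet_Ici, integral_Ici_eq_integral_Ioi,
    setIntegral_Ioi_id_mul_exp hlam]

lemma integrable_id_expMeasure (hlam : 0 < lam) : Integrable (fun x => x) (expMeasure lam) :=
  Integrable.of_integral_ne_zero (by rw [integral_id_expMeasure hlam]; positivity)

end Exponential

/-! ### Invariant laws and the integral equation -/

section Invariance

variable {E : Type*} [MeasurableSpace E] {M lam q : ℝ} {Γ : ℝ≥0∞} {s : E → ℝ}

/-- The law of the next energy level when the current level, the channel state and the harvested
energy are independent with laws `ν`, `ρ` and the exponential law of rate `lam`; a channel state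
`z` has SNR `s z`. -/
noncomputable def nextLaw (M : ℝ) (Γ : ℝ≥0∞) (s : E → ℝ) (ρ : Measure E) (lam : ℝ)
    (ν : Measure ℝ) : Measure ℝ :=
  (ν.prod (ρ.prod (expMeasure lam))).map fun p => ibepStep M Γ p.1 (s p.2.1) p.2.2

lemma measurable_ibepStep_comp (hs : Measurable s) :
    Measurable (fun p : ℝ × E × ℝ => ibepStep M Γ p.1 (s p.2.1) p.2.2) :=
  measurable_ibepStep.comp (f := fun p : ℝ × E × ℝ => (p.1, s p.2.1, p.2.2)) (by fun_prop)

lemma ibepStep_le_iff (b g t x : ℝ) : ibepStep M Γ b g t ≤ x ↔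
    if Γ ≤ ENNReal.ofReal g then b ≤ x - t else t ≤ x ∧ b ≤ x - t + M := by
  unfold ibepStep
  split_ifs with h1 h2
  · constructor <;> intro h <;> linarith
  · constructor
    · intro h; constructor <;> linarith
    · rintro ⟨h, h'⟩; linarith
  · constructor
    · intro h; constructor <;> linarith
    · exact fun h => h.1

/-- The distribution function of the next energy level, from conditioning on the harvested energy
`t` and on the outcome of the transmission. -/
lemma nextLaw_Iic (hlam : 0 < lam) (hq : 0 ≤ q) (hs : Measurable s) {ρ : Measure E}
    [IsProbabilityMeasure ρ] (hρ : ρ {z | Γ ≤ ENNReal.ofReal (s z)} = ENNReal.ofReal q)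
    {ν : Measure ℝ} [IsProbabilityMeasure ν] (hν : ∀ x < 0, cdf ν x = 0) (x : ℝ) :
    nextLaw M Γ s ρ lam ν (Set.Iic x) = ∫⁻ t in Set.Icc 0 x, ENNReal.ofReal
      (q * exponentialPDFReal lam t * cdf ν (x - t)
        + (1 - q) * exponentialPDFReal lam t * cdf ν (x + M - t)) := by
  have := isProbabilityMeasure_expMeasure hlam
  have hA : MeasurableSet {z | Γ ≤ ENNReal.ofReal (s z)} :=
    measurableSet_le measurable_const (by fun_prop)
  have hq1 : q ≤ 1 := by
    rw [← ENNReal.ofReal_le_one, ← hρ]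
    exact prob_le_one
  have hρc : ρ {z | Γ ≤ ENNReal.ofReal (s z)}ᶜ = ENNReal.ofReal (1 - q) := by
    rw [prob_compl_eq_one_sub hA, hρ, ENNReal.ofReal_sub _ hq, ENNReal.ofReal_one]
  have hstep : Measurable (fun p : ℝ × E × ℝ => ibepStep M Γ p.1 (s p.2.1) p.2.2) :=
    measurable_ibepStep_comp hs
  have hpre : MeasurableSet
      ((fun p : ℝ × E × ℝ => ibepStep M Γ p.1 (s p.2.1) p.2.2) ⁻¹' Set.Iic x) :=
    hstep measurableSet_Iic
  have hslice : ∀ (z : E) (t : ℝ), ν ((fun b => (b, z, t)) ⁻¹'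
      ((fun p : ℝ × E × ℝ => ibepStep M Γ p.1 (s p.2.1) p.2.2) ⁻¹' Set.Iic x))
      = {z | Γ ≤ ENNReal.ofReal (s z)}.indicator
          (fun _ => ENNReal.ofReal (cdf ν (x - t))) z
        + {z | Γ ≤ ENNReal.ofReal (s z)}ᶜ.indicator
          (fun _ => (Set.Iic x).indicator
            (fun t => ENNReal.ofReal (cdf ν (x + M - t))) t) z := by
    intro z t
    have h : (fun b => (b, z, t)) ⁻¹'
        ((fun p : ℝ × E × ℝ => ibepStep M Γ p.1 (s p.2.1) p.2.2) ⁻¹' Set.Iic x)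
        = {b | if Γ ≤ ENNReal.ofReal (s z) then b ≤ x - t else t ≤ x ∧ b ≤ x - t + M} := by
      ext b
      exact ibepStep_le_iff b (s z) t x
    rw [h]
    by_cases hz : Γ ≤ ENNReal.ofReal (s z)
    · simp only [hz, if_true, Set.indicator_apply, Set.mem_ofPred_eq, Set.mem_compl_iff,
        not_true_eq_false, if_false, add_zero, ofReal_cdf]
      rfl
    · by_cases ht : t ≤ x
      · simp only [hz, ht, if_true, Set.indicator_apply, Set.mem_ofPred_eq, Set.mem_compl_iff,
          not_false_eq_true, if_false, zero_add, ofReal_cdf, true_and, Set.mem_Iic]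
        rw [show x - t + M = x + M - t by ring]
        rfl
      · simp [hz, ht]
  have hGm : Measurable (cdf ν) := (monotone_cdf ν).measurable
  have hfm := measurable_exponentialPDFReal lam
  rw [nextLaw, Measure.map_apply hstep measurableSet_Iic, Measure.prod_apply_symm hpre,
    lintegral_prod_symm' _ (measurable_measure_prodMk_right hpre)]
  simp_rw [hslice]
  have hz : ∀ t : ℝ, ∫⁻ z, ({z | Γ ≤ ENNReal.ofReal (s z)}.indicator
          (fun _ => ENNReal.ofReal (cdf ν (x - t))) z
        + {z | Γ ≤ ENNReal.ofReal (s z)}ᶜ.indicator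
          (fun _ => (Set.Iic x).indicator
            (fun t => ENNReal.ofReal (cdf ν (x + M - t))) t) z) ∂ρ
      = ENNReal.ofReal (cdf ν (x - t)) * ENNReal.ofReal q
        + (Set.Iic x).indicator (fun t => ENNReal.ofReal (cdf ν (x + M - t))) t
          * ENNReal.ofReal (1 - q) := by
    intro t
    rw [lintegral_add_left (measurable_const.indicator hA), lintegral_indicator_const hA,
      lintegral_indicator_const hA.compl, hρ, hρc]
  simp_rw [hz]
  have hm : Measurable fun t => ENNReal.ofReal (cdf ν (x - t)) * ENNReal.ofReal q
        + (Set.Iic x).indicator (fun t => ENNReal.ofReal (cdf ν (x + M - t))) t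
          * ENNReal.ofReal (1 - q) := by
    have h2 : Measurable fun t => ENNReal.ofReal (cdf ν (x + M - t)) := by fun_prop
    have h1 : Measurable fun t => ENNReal.ofReal (cdf ν (x - t)) * ENNReal.ofReal q := by
      fun_prop
    exact h1.add ((h2.indicator measurableSet_Iic).mul_const _)
  rw [expMeasure_eq_withDensity, lintegral_withDensity_eq_lintegral_mul _
    measurable_exponentialPDF hm, ← lintegral_indicator measurableSet_Icc]
  refine lintegral_congr fun t => ?_
  simp only [Pi.mul_apply, Set.indicator_apply, Set.mem_Icc, Set.mem_Iic]
  rcases lt_or_ge t 0 with ht | ht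
  · simp [exponentialPDF_of_neg ht, not_le.2 ht]
  rcases lt_or_ge x t with htx | htx
  · simp [hν (x - t) (by linarith), not_le.2 htx]
  have hf := exponentialPDFReal_nonneg hlam t
  have h1 := cdf_nonneg ν (x - t)
  have h2 := cdf_nonneg ν (x + M - t)
  have h1q : 0 ≤ 1 - q := by linarith
  simp only [ht, htx, and_self, if_true, exponentialPDF]
  rw [← ENNReal.ofReal_mul h1, ← ENNReal.ofReal_mul h2, ← ENNReal.ofReal_add (by positivity)
    (by positivity), ← ENNReal.ofReal_mul hf]
  congr 1
  ring

/-- The right side of the integral equation, with both terms written as integrals over the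
harvested energy: the ACK term is reflected by `u ↦ x - u`. -/
lemma integral_equation_rhs (hlam : 0 < lam) (ν : Measure ℝ) (x : ℝ) :
    IntervalIntegrable (fun t => q * exponentialPDFReal lam t * cdf ν (x - t)
        + (1 - q) * exponentialPDFReal lam t * cdf ν (x + M - t)) volume 0 x ∧
    ∫ u in (0 : ℝ)..x, (q * exponentialPDFReal lam (x - u) * cdf ν u
        + (1 - q) * exponentialPDFReal lam u * cdf ν (x + M - u))
      = ∫ t in (0 : ℝ)..x, (q * exponentialPDFReal lam t * cdf ν (x - t)
        + (1 - q) * exponentialPDFReal lam t * cdf ν (x + M - t)) := by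
  have hGm : Measurable (cdf ν) := (monotone_cdf ν).measurable
  have hfm := measurable_exponentialPDFReal lam
  have hint : ∀ (c : ℝ) (a b : ℝ → ℝ), Measurable a → Measurable b →
      IntervalIntegrable (fun t => c * exponentialPDFReal lam (a t) * cdf ν (b t))
        volume 0 x := by
    intro c a b ha hb
    refine (intervalIntegrable_const (c := |c| * lam)).mono_fun
      (Measurable.aestronglyMeasurable (by fun_prop)) (ae_of_all _ fun t => ?_)
    have h1 : |exponentialPDFReal lam (a t)| ≤ lam := by
      rw [abs_of_nonneg (exponentialPDFReal_nonneg hlam _)]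
      rcases lt_or_ge (a t) 0 with h | h
      · simp [exponentialPDFReal, gammaPDFReal, not_le.2 h, hlam.le]
      · rw [exponentialPDFReal_of_nonneg h]
        have : Real.exp (-(lam * a t)) ≤ 1 := Real.exp_le_one_iff.2 (by
          have := mul_nonneg hlam.le h
          linarith)
        nlinarith
    have h2 : |cdf ν (b t)| ≤ 1 := by
      rw [abs_of_nonneg (cdf_nonneg _ _)]
      exact cdf_le_one _ _
    simp only [Real.norm_eq_abs]
    rw [abs_mul, abs_mul, abs_mul, abs_abs,
      abs_of_pos hlam]
    calc |c| * |exponentialPDFReal lam (a t)| * |cdf ν (b t)| ≤ |c| * lam * 1 := by gcongr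
      _ = |c| * lam := mul_one _
  have i1 := hint q (fun t => t) (fun t => x - t) (by fun_prop) (by fun_prop)
  have i2 := hint (1 - q) (fun t => t) (fun t => x + M - t) (by fun_prop) (by fun_prop)
  have i3 := hint q (fun t => x - t) (fun t => t) (by fun_prop) (by fun_prop)
  refine ⟨i1.add i2, ?_⟩
  rw [intervalIntegral.integral_add i3 i2, intervalIntegral.integral_add i1 i2]
  congr 1
  have := intervalIntegral.integral_comp_sub_left (a := 0) (b := x)
    (fun t => q * exponentialPDFReal lam t * cdf ν (x - t)) x
  simpa using this

/-- At `x = 0` the equation reads `G 0 = 0`, so a solution carries no mass on `(-∞, 0]`. -/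
lemma SatisfiesIntegralEquation.cdf_eq_zero {ν : Measure ℝ}
    (h : SatisfiesIntegralEquation M lam q (cdf ν)) {x : ℝ} (hx : x ≤ 0) : cdf ν x = 0 := by
  have h0 : cdf ν 0 = 0 := by simpa using h 0 le_rfl
  exact le_antisymm (h0 ▸ monotone_cdf ν hx) (cdf_nonneg _ _)

/-- A law whose distribution function satisfies the integral equation is invariant. -/
lemma SatisfiesIntegralEquation.nextLaw_eq (hlam : 0 < lam) (hq : 0 ≤ q)
    (hs : Measurable s) {ρ : Measure E} [IsProbabilityMeasure ρ]
    (hρ : ρ {z | Γ ≤ ENNReal.ofReal (s z)} = ENNReal.ofReal q)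
    {ν : Measure ℝ} [IsProbabilityMeasure ν] (h : SatisfiesIntegralEquation M lam q (cdf ν)) :
    nextLaw M Γ s ρ lam ν = ν := by
  have := isProbabilityMeasure_expMeasure hlam
  have hstep : Measurable (fun p : ℝ × E × ℝ => ibepStep M Γ p.1 (s p.2.1) p.2.2) :=
    measurable_ibepStep_comp hs
  have : IsProbabilityMeasure (nextLaw M Γ s ρ lam ν) :=
    Measure.isProbabilityMeasure_map hstep.aemeasurable
  have hq1 : q ≤ 1 := by
    rw [← ENNReal.ofReal_le_one, ← hρ]
    exact prob_le_one
  refine Measure.ext_of_Iic _ _ fun x => ?_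
  rw [nextLaw_Iic hlam hq hs hρ (fun x hx => h.cdf_eq_zero hx.le), ← ofReal_cdf]
  rcases lt_or_ge x 0 with hx | hx
  · simp [h.cdf_eq_zero hx.le, hx]
  obtain ⟨hi, heq⟩ := integral_equation_rhs (q := q) (M := M) hlam ν x
  rw [h x hx, heq, intervalIntegral.integral_of_le hx, ← integral_Icc_eq_integral_Ioc,
    ofReal_integral_eq_lintegral_ofReal]
  · rwa [intervalIntegrable_iff_integrableOn_Icc_of_le hx] at hi
  · refine ae_of_all _ fun t => ?_
    have hf := exponentialPDFReal_nonneg hlam t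
    have h1 := cdf_nonneg ν (x - t)
    have h2 := cdf_nonneg ν (x + M - t)
    have h1q : 0 ≤ 1 - q := by linarith
    simp only [Pi.zero_apply]
    positivity

end Invariance

/-! ### The exponent -/

section Exponent

/-- `lambertW` inverts `w ↦ w * exp w` on the range `[-1/e, 0]` needed for the exponent. -/
lemma lambertW_spec {y : ℝ} (h1 : -Real.exp (-1) ≤ y) (h2 : y ≤ 0) :
    -1 ≤ lambertW y ∧ lambertW y * Real.exp (lambertW y) = y := by
  have hcont : ContinuousOn (fun w : ℝ => w * Real.exp w) (Set.Icc (-1) 0) := by fun_prop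
  obtain ⟨w, hw, hwy⟩ := intermediate_value_Icc (by norm_num) hcont
    (show y ∈ Set.Icc _ _ by simpa using ⟨h1, h2⟩)
  have hex : ∃ w ∈ Set.Ici (-1 : ℝ), (fun w : ℝ => w * Real.exp w) w = y := ⟨w, hw.1, hwy⟩
  exact ⟨Function.invFunOn_mem hex, Function.invFunOn_eq hex⟩

variable {M lam q : ℝ}

/-- The exponent is the positive root of `Z = (1 - q) λ (1 - exp (-M Z))`. -/
lemma Z1_spec (hM : 0 < M) (hphi : 1 < phiInc M lam q) :
    0 < Z1 M lam q ∧
      (1 - q) * lam - Z1 M lam q = (1 - q) * lam * Real.exp (-(M * Z1 M lam q)) := by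
  set a := (1 - q) * lam * M with ha
  have ha1 : 1 < a := by
    rw [phiInc] at hphi
    linarith [show M * lam * (1 - q) = a by rw [ha]; ring]
  -- `a * exp (-a)` is at most its value `1 / e` at `a = 1`.
  have hlow : -Real.exp (-1) ≤ -a * Real.exp (-a) := by
    have h := Real.add_one_le_exp (a - 1)
    have h' : a * Real.exp (-a) ≤ Real.exp (a - 1) * Real.exp (-a) := by
      gcongr; linarith
    rw [← Real.exp_add, show a - 1 + -a = -1 by ring] at h'
    linarith
  have hneg : -a * Real.exp (-a) ≤ 0 := by
    have := Real.exp_pos (-a)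
    nlinarith
  obtain ⟨hw1, hw2⟩ := lambertW_spec hlow hneg
  set w := lambertW (-a * Real.exp (-a)) with hw
  have hZ : Z1 M lam q = (w + a) / M := by
    rw [Z1, ← ha, ← hw]
    field_simp
    rw [ha]; ring
  have hMZ : M * Z1 M lam q = w + a := by
    rw [hZ]; field_simp
  -- Since `w ≥ -1 > -a`, this is not the root `w = -a`, which would give exponent `0`.
  refine ⟨by rw [hZ]; exact div_pos (by linarith) hM, ?_⟩
  have hexp : Real.exp (-(w + a)) * Real.exp w = Real.exp (-a) := by
    rw [← Real.exp_add]; congr 1; ring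
  have hkey : -w = a * Real.exp (-(w + a)) := by
    have hpos := Real.exp_pos w
    apply mul_right_cancel₀ hpos.ne'
    rw [mul_assoc, hexp]
    linarith
  rw [hMZ, hZ]
  field_simp
  rw [← ha]
  linarith

/-- The exponential distribution function solves the integral equation when its exponent solves
the characteristic equation. -/
lemma satisfiesIntegralEquation_expMeasure (hM : 0 < M) (hlam : 0 < lam) (hq : 0 ≤ q)
    (hphi : 1 < phiInc M lam q) :
    SatisfiesIntegralEquation M lam q (cdf (expMeasure (Z1 M lam q))) := by
  obtain ⟨hZ, hroot⟩ := Z1_spec hM hphi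
  set Z := Z1 M lam q
  -- The characteristic equation gives `lam - Z = q * lam + (1 - q) * lam * exp (-M * Z)`.
  have hlZ : 0 < lam - Z := by
    have h1 : 0 < 1 - q := by
      by_contra! h
      rw [phiInc] at hphi
      have : M * lam * (1 - q) ≤ 0 := mul_nonpos_of_nonneg_of_nonpos (by positivity) h
      linarith
    have h2 : 0 < (1 - q) * lam * Real.exp (-(M * Z)) := by positivity
    have h3 : 0 ≤ q * lam := by positivity
    linarith
  intro x hx
  -- On `[0, x]` the integrand is a combination of exponentials, with an explicit primitive.
  have hcongr : ∀ u ∈ Set.uIcc 0 x,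
      (q * exponentialPDFReal lam (x - u) * cdf (expMeasure Z) u
        + (1 - q) * exponentialPDFReal lam u * cdf (expMeasure Z) (x + M - u))
      = q * lam * Real.exp (-(lam * (x - u)))
        - q * lam * (Real.exp (-(lam * x)) * Real.exp ((lam - Z) * u))
        + ((1 - q) * lam * Real.exp (-(lam * u))
        - (1 - q) * lam * Real.exp (-(M * Z))
          * (Real.exp (-(Z * x)) * Real.exp (-((lam - Z) * u)))) := by
    intro u hu
    rw [Set.uIcc_of_le hx] at hu
    rw [cdf_expMeasure_eq hZ, cdf_expMeasure_eq hZ, if_pos hu.1,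
      if_pos (by linarith [hu.2]), exponentialPDFReal_of_nonneg hu.1,
      exponentialPDFReal_of_nonneg (by linarith [hu.2])]
    have e1 : Real.exp (-(lam * x)) * Real.exp ((lam - Z) * u)
        = Real.exp (-(lam * (x - u))) * Real.exp (-(Z * u)) := by
      rw [← Real.exp_add, ← Real.exp_add]; congr 1; ring
    have e2 : Real.exp (-(M * Z)) * (Real.exp (-(Z * x)) * Real.exp (-((lam - Z) * u)))
        = Real.exp (-(lam * u)) * Real.exp (-(Z * (x + M - u))) := by
      rw [← Real.exp_add, ← Real.exp_add, ← Real.exp_add]; congr 1; ring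
    rw [mul_assoc ((1 - q) * lam), e2, e1]
    ring
  have hderiv : ∀ u ∈ Set.uIcc 0 x, HasDerivAt (fun u =>
      q * Real.exp (-(lam * (x - u)))
        - q * lam * (Real.exp (-(lam * x)) * (Real.exp ((lam - Z) * u) / (lam - Z)))
        + (-(1 - q) * Real.exp (-(lam * u))
        + (1 - q) * lam * Real.exp (-(M * Z))
          * (Real.exp (-(Z * x)) * (Real.exp (-((lam - Z) * u)) / (lam - Z)))))
      (q * lam * Real.exp (-(lam * (x - u)))
        - q * lam * (Real.exp (-(lam * x)) * Real.exp ((lam - Z) * u))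
        + ((1 - q) * lam * Real.exp (-(lam * u))
        - (1 - q) * lam * Real.exp (-(M * Z))
          * (Real.exp (-(Z * x)) * Real.exp (-((lam - Z) * u))))) u := by
    intro u _
    have d1 : HasDerivAt (fun u => Real.exp (-(lam * (x - u))))
        (Real.exp (-(lam * (x - u))) * -(lam * (-1))) u :=
      ((((hasDerivAt_id u).const_sub x).const_mul lam).fun_neg).exp
    have d2 : HasDerivAt (fun u => Real.exp ((lam - Z) * u))
        (Real.exp ((lam - Z) * u) * ((lam - Z) * 1)) u :=
      ((hasDerivAt_id u).const_mul (lam - Z)).exp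
    have d3 : HasDerivAt (fun u => Real.exp (-(lam * u)))
        (Real.exp (-(lam * u)) * -(lam * 1)) u :=
      (((hasDerivAt_id u).const_mul lam).fun_neg).exp
    have d4 : HasDerivAt (fun u => Real.exp (-((lam - Z) * u)))
        (Real.exp (-((lam - Z) * u)) * -((lam - Z) * 1)) u :=
      (((hasDerivAt_id u).const_mul (lam - Z)).fun_neg).exp
    convert! ((d1.const_mul q).sub
      (((d2.div_const (lam - Z)).const_mul (Real.exp (-(lam * x)))).const_mul (q * lam))).add
      ((d3.const_mul (-(1 - q))).add
      (((d4.div_const (lam - Z)).const_mul (Real.exp (-(Z * x)))).const_mul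
        ((1 - q) * lam * Real.exp (-(M * Z))))) using 1
    field_simp
    ring
  rw [intervalIntegral.integral_congr hcongr, intervalIntegral.integral_eq_sub_of_hasDerivAt hderiv
    (Continuous.intervalIntegrable (by fun_prop) _ _), cdf_expMeasure_eq hZ, if_pos hx, ← hroot]
  have e3 : Real.exp (-(lam * x)) * Real.exp ((lam - Z) * x) = Real.exp (-(Z * x)) := by
    rw [← Real.exp_add]; congr 1; ring
  have e4 : Real.exp (-(Z * x)) * Real.exp (-((lam - Z) * x)) = Real.exp (-(lam * x)) := by
    rw [← Real.exp_add]; congr 1; ring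
  rw [← mul_div_assoc, e3,
    ← mul_div_assoc (Real.exp (-(Z * x))) (Real.exp (-((lam - Z) * x))), e4]
  simp only [sub_self, mul_zero, neg_zero, Real.exp_zero, sub_zero]
  field_simp
  ring

end Exponent

/-! ### Convergence of the buffer -/

section Convergence

variable {Ω E : Type*} [MeasurableSpace Ω] [MeasurableSpace E] {P : Measure Ω}
  {M lam q : ℝ} {Γ : ℝ≥0∞} {s : E → ℝ} {Z : ℕ → Ω → E} {X : ℕ → Ω → ℝ}
  {ρ : Measure E} {ν : Measure ℝ}

/-- The energy level at time `i` of a buffer with deterministic initial level is a function of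
the inputs before time `i`, hence independent of the input at time `i`. -/
lemma indepFun_ibepBuffer (hs : Measurable s) (hZ : ∀ i, Measurable (Z i))
    (hX : ∀ i, Measurable (X i)) (hind : iIndepFun (fun i ω => (Z i ω, X i ω)) P) (c : ℝ)
    (i : ℕ) :
    IndepFun (ibepBuffer M Γ (fun _ => c) (fun i ω => s (Z i ω)) X i)
      (fun ω => (Z i ω, X i ω)) P := by
  let m : ℕ → MeasurableSpace Ω := fun j =>
    MeasurableSpace.comap (fun ω => (Z j ω, X j ω)) inferInstance
  have hm : ∀ j, Measurable[m j] (fun ω => (Z j ω, X j ω)) := fun j => comap_measurable _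
  have hle : ∀ j, m j ≤ ‹MeasurableSpace Ω› := fun j =>
    ((hZ j).prodMk (hX j)).comap_le
  have hind' := indep_iSup_of_disjoint hle hind (S := {j | j < i}) (T := {i})
    (by simp)
  have hpast : Measurable[⨆ j ∈ {j | j < i}, m j]
      (ibepBuffer M Γ (fun _ => c) (fun i ω => s (Z i ω)) X i) := by
    have hj : ∀ j < i, Measurable[⨆ j ∈ {j | j < i}, m j] (fun ω => (Z j ω, X j ω)) :=
      fun j hj => (hm j).mono (le_iSup₂_of_le j hj le_rfl) le_rfl
    refine measurable_ibepBuffer (m := ⨆ j ∈ {j | j < i}, m j) (@measurable_const _ _ _ (_) _) i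
      (fun j hji => hs.comp (measurable_fst.comp (hj j hji)))
      (fun j hji => measurable_snd.comp (hj j hji))
  rw [IndepFun_iff_Indep]
  refine indep_of_indep_of_le_left (indep_of_indep_of_le_right hind' ?_) hpast.comap_le
  exact le_iSup₂_of_le i rfl le_rfl

/-- A buffer whose initial level is independent of the inputs and has an invariant law keeps that
law. The initial level is the second coordinate on a product space. -/
lemma map_ibepBuffer_snd [IsProbabilityMeasure P] (hs : Measurable s) (hZ : ∀ i, Measurable (Z i))
    (hX : ∀ i, Measurable (X i)) (hind : iIndepFun (fun i ω => (Z i ω, X i ω)) P)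
    [SigmaFinite ρ] [SigmaFinite (expMeasure lam)]
    (hlaw : ∀ i, P.map (fun ω => (Z i ω, X i ω)) = ρ.prod (expMeasure lam))
    [IsProbabilityMeasure ν] (hν : nextLaw M Γ s ρ lam ν = ν) (i : ℕ) :
    (P.prod ν).map (ibepBuffer M Γ Prod.snd (fun i p => s (Z i p.1)) (fun i p => X i p.1) i)
      = ν := by
  set C := ibepBuffer M Γ Prod.snd (fun i (p : Ω × ℝ) => s (Z i p.1)) (fun i p => X i p.1)
    with hC
  have hCm : ∀ i, Measurable (C i) := fun i =>
    measurable_ibepBuffer measurable_snd i (fun j _ => hs.comp ((hZ j).comp measurable_fst))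
      (fun j _ => (hX j).comp measurable_fst)
  induction i with
  | zero =>
    change (P.prod ν).map Prod.snd = ν
    rw [Measure.map_snd_prod, measure_univ, one_smul]
  | succ i ih =>
    have hY : Measurable (fun ω => (Z i ω, X i ω)) := (hZ i).prodMk (hX i)
    have hjoint : Measurable (fun p : Ω × ℝ => (C i p, (Z i p.1, X i p.1))) :=
      (hCm i).prodMk (hY.comp measurable_fst)
    have hprod : (P.prod ν).map (fun p => (C i p, (Z i p.1, X i p.1)))
        = ν.prod (ρ.prod (expMeasure lam)) := by
      symm
      -- On rectangles: slice by the initial level `c`, for which independence holds on `Ω`.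
      refine Measure.prod_eq fun S T hS hT => ?_
      have hslice : ∀ c : ℝ, (fun ω => (ω, c)) ⁻¹' ((fun p : Ω × ℝ =>
          (C i p, (Z i p.1, X i p.1))) ⁻¹' S ×ˢ T)
          = ibepBuffer M Γ (fun _ => c) (fun i ω => s (Z i ω)) X i ⁻¹' S
            ∩ (fun ω => (Z i ω, X i ω)) ⁻¹' T := by
        intro c
        ext ω
        have h : C i (ω, c) = ibepBuffer M Γ (fun _ => c) (fun i ω => s (Z i ω)) X i ω :=
          ibepBuffer_comp Prod.fst Prod.snd (fun i ω => s (Z i ω)) X i (ω, c)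
        simp [h]
      have hslice' : ∀ c : ℝ, (fun ω => (ω, c)) ⁻¹' (C i ⁻¹' S)
          = ibepBuffer M Γ (fun _ => c) (fun i ω => s (Z i ω)) X i ⁻¹' S := by
        intro c
        ext ω
        have h : C i (ω, c) = ibepBuffer M Γ (fun _ => c) (fun i ω => s (Z i ω)) X i ω :=
          ibepBuffer_comp Prod.fst Prod.snd (fun i ω => s (Z i ω)) X i (ω, c)
        simp [h]
      have hS' : ν S = ∫⁻ c,
          P (ibepBuffer M Γ (fun _ => c) (fun i ω => s (Z i ω)) X i ⁻¹' S) ∂ν := by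
        rw [← ih, Measure.map_apply (hCm i) hS, Measure.prod_apply_symm (hCm i hS), ih]
        simp_rw [hslice']
      have hmeas := measurable_measure_prodMk_right (μ := P) (hCm i hS)
      simp_rw [hslice'] at hmeas
      rw [Measure.map_apply hjoint (hS.prod hT),
        Measure.prod_apply_symm (hjoint (hS.prod hT)), ← hlaw i, Measure.map_apply hY hT, hS',
        ← lintegral_mul_const _ hmeas]
      refine lintegral_congr fun c => ?_
      rw [hslice c]
      exact indepFun_iff_measure_inter_preimage_eq_mul.1
        (indepFun_ibepBuffer hs hZ hX hind c i) S T hS hT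
    calc (P.prod ν).map (C (i + 1))
        = ((P.prod ν).map (fun p => (C i p, (Z i p.1, X i p.1)))).map
            (fun p => ibepStep M Γ p.1 (s p.2.1) p.2.2) := by
          rw [Measure.map_map (measurable_ibepStep_comp hs) hjoint]
          rfl
      _ = nextLaw M Γ s ρ lam ν := by rw [hprod, nextLaw]
      _ = ν := hν

lemma measurable_netIncrement : Measurable (fun p : ℝ × ℝ => netIncrement M Γ p.1 p.2) := by
  unfold netIncrement
  exact measurable_snd.sub (Measurable.ite (measurableSet_le measurable_const (by fun_prop))
    measurable_const measurable_const)

/-- The strong law of large numbers for the net increments, whose mean is `1/λ - (1 - q) M`. -/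
lemma ae_tendsto_netIncrement [IsProbabilityMeasure P] (hlam : 0 < lam) (hq : 0 ≤ q)
    (hs : Measurable s)
    (hZ : ∀ i, Measurable (Z i)) (hX : ∀ i, Measurable (X i))
    (hind : iIndepFun (fun i ω => (Z i ω, X i ω)) P) [IsProbabilityMeasure ρ]
    (hlaw : ∀ i, P.map (fun ω => (Z i ω, X i ω)) = ρ.prod (expMeasure lam))
    (hρ : ρ {z | Γ ≤ ENNReal.ofReal (s z)} = ENNReal.ofReal q) :
    ∀ᵐ ω ∂P, Tendsto (fun n : ℕ =>
      (∑ j ∈ Finset.range n, netIncrement M Γ (s (Z j ω)) (X j ω)) / n) atTop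
      (𝓝 (1 / lam - (1 - q) * M)) := by
  have := isProbabilityMeasure_expMeasure hlam
  have hA : MeasurableSet {z | Γ ≤ ENNReal.ofReal (s z)} :=
    measurableSet_le measurable_const (by fun_prop)
  have hYm : ∀ i, Measurable (fun ω => (Z i ω, X i ω)) := fun i => (hZ i).prodMk (hX i)
  let φ : E × ℝ → ℝ := fun y => netIncrement M Γ (s y.1) y.2
  have hφ : Measurable φ :=
    measurable_netIncrement.comp (f := fun y : E × ℝ => (s y.1, y.2)) (by fun_prop)
  have hdecomp : φ = fun y => y.2 - {z | Γ ≤ ENNReal.ofReal (s z)}ᶜ.indicator (fun _ => M) y.1 := by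
    funext y
    simp only [φ, netIncrement, Set.indicator_apply, Set.mem_compl_iff, Set.mem_ofPred_eq]
    split_ifs <;> rfl
  have hint1 : Integrable (fun y : E × ℝ => y.2) (ρ.prod (expMeasure lam)) :=
    (integrable_id_expMeasure hlam).comp_snd ρ
  have hint2' : Integrable ({z | Γ ≤ ENNReal.ofReal (s z)}ᶜ.indicator (fun _ => M)) ρ :=
    (integrable_const M).indicator hA.compl
  have hint2 : Integrable (fun y : E × ℝ =>
      {z | Γ ≤ ENNReal.ofReal (s z)}ᶜ.indicator (fun _ => M) y.1) (ρ.prod (expMeasure lam)) :=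
    hint2'.comp_fst _
  have hintφ : Integrable φ (ρ.prod (expMeasure lam)) := by
    rw [hdecomp]; exact hint1.sub hint2
  have hmean : ∫ y, φ y ∂(ρ.prod (expMeasure lam)) = 1 / lam - (1 - q) * M := by
    rw [hdecomp, integral_sub hint1 hint2, integral_fun_snd (fun x : ℝ => x),
      integral_fun_fst, integral_id_expMeasure hlam, integral_indicator_const _ hA.compl,
      probReal_compl_eq_one_sub hA, measureReal_def _ {z | _}, hρ, ENNReal.toReal_ofReal hq]
    simp
  have hident : ∀ i, IdentDistrib (fun ω => φ (Z i ω, X i ω)) (fun ω => φ (Z 0 ω, X 0 ω)) P P :=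
    fun i => (IdentDistrib.mk (hYm i).aemeasurable (hYm 0).aemeasurable
      (by rw [hlaw i, hlaw 0])).comp hφ
  have h0 : Integrable (fun ω => φ (Z 0 ω, X 0 ω)) P := by
    rw [← hlaw 0] at hintφ
    exact hintφ.comp_measurable (hYm 0)
  have hE : ∫ ω, φ (Z 0 ω, X 0 ω) ∂P = 1 / lam - (1 - q) * M := by
    rw [← hmean, ← hlaw 0, integral_map (hYm 0).aemeasurable hφ.aestronglyMeasurable]
  rw [← hE]
  exact strong_law_ae_real (fun i ω => φ (Z i ω, X i ω)) h0
    (fun i j hij => (hind.indepFun hij).comp hφ hφ) hident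

/-- Coupling: every law solving the integral equation is the limit law of the buffer, because the
buffer merges almost surely with a stationary copy driven by the same inputs. -/
lemma tendstoInDistribution_ibepBuffer [IsProbabilityMeasure P] (hlam : 0 < lam) (hq : 0 ≤ q)
    (hphi : 1 < phiInc M lam q) (hs : Measurable s) (hZ : ∀ i, Measurable (Z i))
    (hX : ∀ i, Measurable (X i)) (hind : iIndepFun (fun i ω => (Z i ω, X i ω)) P)
    [IsProbabilityMeasure ρ]
    (hlaw : ∀ i, P.map (fun ω => (Z i ω, X i ω)) = ρ.prod (expMeasure lam))
    (hρ : ρ {z | Γ ≤ ENNReal.ofReal (s z)} = ENNReal.ofReal q) {B0 : Ω → ℝ}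
    (hB0m : Measurable B0) (hB0 : ∀ᵐ ω ∂P, 0 ≤ B0 ω) [IsProbabilityMeasure ν]
    (hν : SatisfiesIntegralEquation M lam q (cdf ν)) :
    TendstoInDistribution (ibepBuffer M Γ B0 (fun i ω => s (Z i ω)) X) atTop (id : ℝ → ℝ)
      (fun _ => P) ν := by
  have := isProbabilityMeasure_expMeasure hlam
  have hdrift : 1 / lam - (1 - q) * M < 0 := by
    rw [phiInc] at hphi
    rw [sub_neg, div_lt_iff₀ hlam]
    linarith
  set B := ibepBuffer M Γ B0 (fun i ω => s (Z i ω)) X with hB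
  set C := ibepBuffer M Γ Prod.snd (fun i (p : Ω × ℝ) => s (Z i p.1)) (fun i p => X i p.1)
    with hC
  have hBm : ∀ i, Measurable (B i) := fun i =>
    measurable_ibepBuffer hB0m i (fun j _ => hs.comp (hZ j)) (fun j _ => hX j)
  have hCm : ∀ i, Measurable (C i) := fun i =>
    measurable_ibepBuffer measurable_snd i (fun j _ => hs.comp ((hZ j).comp measurable_fst))
      (fun j _ => (hX j).comp measurable_fst)
  have hCmap : ∀ i, (P.prod ν).map (C i) = ν :=
    map_ibepBuffer_snd hs hZ hX hind hlaw (hν.nextLaw_eq hlam hq hs hρ)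
  have hBmap : ∀ i, (P.prod ν).map (fun p => B i p.1) = P.map (B i) := by
    intro i
    have h := Measure.map_map (μ := P.prod ν) (hBm i) measurable_fst
    rw [Measure.map_fst_prod, measure_univ, one_smul] at h
    exact h.symm
  have hXnn : ∀ᵐ ω ∂P, ∀ i, 0 ≤ X i ω := by
    rw [ae_all_iff]
    intro i
    have h : P.map (X i) = expMeasure lam := by
      have h := Measure.map_map (μ := P) measurable_snd ((hZ i).prodMk (hX i))
      rw [hlaw i, Measure.map_snd_prod, measure_univ, one_smul] at h
      exact h.symm
    have h' := ae_expMeasure_nonneg (lam := lam)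
    rw [← h] at h'
    exact ae_of_ae_map (hX i).aemeasurable h'
  have hνnn : ∀ᵐ c ∂ν, 0 ≤ c := by
    have h : ν (Set.Iic 0) = 0 := by rw [← ofReal_cdf, hν.cdf_eq_zero le_rfl, ENNReal.ofReal_zero]
    filter_upwards [measure_eq_zero_iff_ae_notMem.1 h] with c hc
    exact (not_le.1 hc).le
  have hfst : Measure.QuasiMeasurePreserving Prod.fst (P.prod ν) P :=
    Measure.quasiMeasurePreserving_fst
  have hsnd : Measure.QuasiMeasurePreserving Prod.snd (P.prod ν) ν :=
    Measure.quasiMeasurePreserving_snd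
  -- Both buffers eventually follow the path that starts from an empty buffer.
  have hmerge : ∀ᵐ p ∂P.prod ν, ∀ᶠ i in atTop, B i p.1 = C i p := by
    filter_upwards [hfst.ae hB0, hfst.ae hXnn, hsnd.ae hνnn, hfst.ae
      (ae_tendsto_netIncrement (M := M) (Γ := Γ) hlam hq hs hZ hX hind hlaw hρ)]
      with p hb hx hc hlim
    have h1 := eventually_ibepBuffer_eq (M := M) (Γ := Γ) (B := B0)
      (g := fun i ω => s (Z i ω)) hb hx hdrift hlim
    have h2 := eventually_ibepBuffer_eq (M := M) (Γ := Γ) (B := Prod.snd)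
      (g := fun i (p : Ω × ℝ) => s (Z i p.1)) (X := fun i p => X i p.1) (ω := p) hc hx hdrift hlim
    filter_upwards [h1, h2] with i e1 e2
    rw [hB, hC, e1, e2]
    exact (ibepBuffer_comp Prod.fst 0 (fun i ω => s (Z i ω)) X i p).symm
  have hstat : TendstoInDistribution C atTop (id : ℝ → ℝ) (fun _ => P.prod ν) ν :=
    tendstoInDistribution_of_identDistrib 0
      (fun j => ⟨(hCm 0).aemeasurable, (hCm j).aemeasurable, by rw [hCmap, hCmap]⟩)
      ⟨(hCm 0).aemeasurable, aemeasurable_id, by rw [hCmap, Measure.map_id]⟩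
  have hdiff : TendstoInMeasure (P.prod ν) ((fun i p => B i p.1) - C) atTop 0 := by
    refine tendstoInMeasure_of_tendsto_ae (fun i =>
      (((hBm i).comp measurable_fst).sub (hCm i)).aestronglyMeasurable) ?_
    filter_upwards [hmerge] with p hp
    refine tendsto_const_nhds.congr' ?_
    filter_upwards [hp] with i hi
    simp [hi]
  have hlift := tendstoInDistribution_of_tendstoInMeasure_sub (fun i (p : Ω × ℝ) => B i p.1) id
    hstat hdiff (fun i => ((hBm i).comp measurable_fst).aemeasurable)
  refine ⟨fun i => (hBm i).aemeasurable, aemeasurable_id, ?_⟩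
  refine hlift.tendsto.congr fun i => ?_
  exact Subtype.ext (hBmap i)

end Convergence

/-! ### The limit law of the energy level -/

theorem theorem1 {Ω : Type*} [MeasurableSpace Ω] (P : Measure Ω) [IsProbabilityMeasure P]
    (PS noise dSD α M lam : ℝ) (hPS : 0 < PS) (hnoise : 0 < noise) (hd : 0 < dSD)
    (hM : 0 < M) (hlam : 0 < lam) (Γ : ℝ≥0∞)
    (B0 : Ω → ℝ) (h : ℕ → Ω → ℂ) (X : ℕ → Ω → ℝ)
    (hB0m : Measurable B0) (hhm : ∀ i, Measurable (h i)) (hXm : ∀ i, Measurable (X i))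
    (hB0 : ∀ᵐ ω ∂P, 0 ≤ B0 ω)
    (hh : ∀ i, HasLaw (h i) (complexGaussian 0 (dSD ^ (-α)).toNNReal) P)
    (hX : ∀ i, HasLaw (X i) (expMeasure lam) P)
    (hind : iIndepFun (fun i ω => (h i ω, X i ω)) P)
    (hind_pair : ∀ i, IndepFun (h i) (X i) P)
    (hind_init : IndepFun B0 (fun ω i => (h i ω, X i ω)) P)
    (hphi : 1 < phiInc M lam (expNegMul (W2 PS noise dSD α) Γ)) :
    ∃ μ : ProbabilityMeasure ℝ,
      TendstoInDistribution
        (ibepBuffer M Γ B0 (fun i ω => linkSNR PS noise (h i ω)) X) atTop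
        (id : ℝ → ℝ) (fun _ => P) (μ : Measure ℝ) ∧
      SatisfiesIntegralEquation M lam (expNegMul (W2 PS noise dSD α) Γ) (cdf (μ : Measure ℝ)) ∧
      (∀ ν : ProbabilityMeasure ℝ,
        SatisfiesIntegralEquation M lam (expNegMul (W2 PS noise dSD α) Γ) (cdf (ν : Measure ℝ)) → ν = μ) ∧
      0 < Z1 M lam (expNegMul (W2 PS noise dSD α) Γ) ∧
      (∀ x : ℝ, x < 0 → cdf (μ : Measure ℝ) x = 0) ∧
      ∀ x : ℝ, 0 ≤ x →
        cdf (μ : Measure ℝ) x = 1 - Real.exp (-(Z1 M lam (expNegMul (W2 PS noise dSD α) Γ) * x)) := by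
  set q := expNegMul (W2 PS noise dSD α) Γ with hqdef
  have hq : 0 ≤ q := expNegMul_nonneg _ _
  have hs : Measurable (linkSNR PS noise) := by
    unfold linkSNR
    fun_prop
  have hρ := complexGaussian_ack hPS hnoise hd (α := α) Γ
  have hρprob := (hh 0).isProbabilityMeasure_iff.1 ‹_›
  have hlaw : ∀ i, P.map (fun ω => (h i ω, X i ω))
      = (complexGaussian 0 (dSD ^ (-α)).toNNReal).prod (expMeasure lam) := by
    intro i
    rw [(indepFun_iff_map_prod_eq_prod_map_map (hhm i).aemeasurable
      (hXm i).aemeasurable).1 (hind_pair i), (hh i).map_eq, (hX i).map_eq]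
  have hconv : ∀ (ν : Measure ℝ) [IsProbabilityMeasure ν],
      SatisfiesIntegralEquation M lam q (cdf ν) →
      TendstoInDistribution (ibepBuffer M Γ B0 (fun i ω => linkSNR PS noise (h i ω)) X) atTop
        (id : ℝ → ℝ) (fun _ => P) ν := fun ν _ hν =>
    tendstoInDistribution_ibepBuffer hlam hq hphi hs hhm hXm hind hlaw hρ hB0m hB0 hν
  have hZ := (Z1_spec hM hphi).1
  have hprob := isProbabilityMeasure_expMeasure hZ
  have heq := satisfiesIntegralEquation_expMeasure hM hlam hq hphi
  refine ⟨⟨expMeasure (Z1 M lam q), hprob⟩, hconv (expMeasure (Z1 M lam q)) heq, heq,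
    fun ν hν => ?_, hZ, fun x hx => heq.cdf_eq_zero hx.le, fun x hx => ?_⟩
  -- Any solution is the limit law of the same buffer.
  · have := tendstoInDistribution_unique _ (hconv ν hν) (hconv (expMeasure (Z1 M lam q)) heq)
    rw [Measure.map_id, Measure.map_id] at this
    exact Subtype.ext this
  · exact (cdf_expMeasure_eq hZ x).trans (if_pos hx)
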